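/- Let $d,K,T$ be natural numbers, let $\mathcal X$ be a measurable space of contexts, and let $\varphi:\mathcal X\times[K]\to\mathbb R^d$ be a measurable feature map with $\|\varphi(x,a)\|\le B$ for all $x\in\mathcal X$, $a\in[K]$ (Euclidean norm). Let $Q_1$ be a prior (a probability measure) on $\mathbb R^d$ supported on a set $\Theta_1$ with $\|\theta\|\le S$ for all $\theta\in\Theta_1$. Consider the logistic bandit with linear logits: under parameter $\theta$, playing action $a$ in context $x$ yields a binary loss in $\{0,1\}$ with law $\mathrm{Ber}(\ell(\theta,x,a))$, where $\ell(\theta,x,a)=\sigma(\langle\varphi(x,a),\theta\rangle)$ and $\sigma(z)=1/(1+e^{-z})$. Let $a^\star(\theta,x)\in\arg\min_a\ell(\theta,x,a)$ be a measurable choice of minimizer (arbitrary tie-breaking). A parameter $\theta^\star\sim Q_1$ is drawn. In each round $t=1,\dots,T$: an adaptive adversary draws a context $X_t$ from a distribution that depends only on the history $H_{t-1}=(X_s,A_s,L_s)_{s<t}$ (conditionally on $H_{t-1}$, $X_t$ does not depend on $\theta^\star$); Thompson Sampling draws $\theta_t$ from the posterior $Q_t$, the regular conditional distribution of $\theta^\star$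 given $H_{t-1}$ (conditionally on $H_{t-1}$, $\theta_t$ is independent of $(\theta^\star,X_t)$), and plays $A_t=a^\star(\theta_t,X_t)$; then a loss $L_t\sim\mathrm{Ber}(\ell(\theta^\star,X_t,A_t))$ is incurred, conditionally on $\theta^\star,H_{t-1},X_t,A_t$. The Bayesian regret is $$R_T=\mathbb E\Big[\sum_{t=1}^T\big(\ell(\theta^\star,X_t,A_t)-\ell(\theta^\star,X_t,a^\star(\theta^\star,X_t))\big)\Big].$$ Then $$R_T\le\sqrt{2KT\big(d\log(2SBT+1)+1\big)}.$$ Moreover this bound is $\widetilde O(\sqrt{dKT})$: there are absolute constants $C>0$ and $p\in\mathbb N$ such that for all integers $d,K,T\ge1$ and all reals $S,B\ge0$, $$\sqrt{2KT\big(d\log(2SBT+1)+1\big)}\le C\sqrt{dKT}\,\big(\log(2+SBT)\big)^p .$$ -/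

import Mathlib

open MeasureTheory ProbabilityTheory

namespace ContextualBandit

/-- A parametric class of contextual bandits with binary losses: parameter space `Θ`, context space
`𝒳` and `K` actions. Under parameter `θ`, playing `a` in context `x` yields a Bernoulli loss with
mean `meanLoss θ x a`. -/
structure BernoulliBandit (Θ 𝒳 : Type*) [MeasurableSpace Θ] [MeasurableSpace 𝒳] (K : ℕ) where
  meanLoss : Θ → 𝒳 → Fin K → unitInterval
  measurable_meanLoss : Measurable fun p : Θ × 𝒳 × Fin K => meanLoss p.1 p.2.1 p.2.2

/-- The logistic bandit with linear logits: `meanLoss θ x a = σ(⟨φ(x, a), θ⟩)` where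
`σ(z) = 1 / (1 + exp (-z))`. -/
noncomputable def linearLogistic {d K : ℕ} {𝒳 : Type*} [MeasurableSpace 𝒳]
    (φ : 𝒳 → Fin K → EuclideanSpace ℝ (Fin d)) (hφ : ∀ a, Measurable fun x => φ x a) :
    BernoulliBandit (EuclideanSpace ℝ (Fin d)) 𝒳 K where
  meanLoss θ x a :=
    ⟨Real.sigmoid (inner ℝ (φ x a) θ), Real.sigmoid_nonneg _, Real.sigmoid_le_one _⟩
  measurable_meanLoss := by
    refine Measurable.subtype_mk ?_
    refine continuous_sigmoid.measurable.comp ?_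
    have h : Measurable fun q : 𝒳 × Fin K => φ q.1 q.2 :=
      measurable_from_prod_countable_left hφ
    exact (h.comp measurable_snd).inner measurable_fst

section

variable {Ω Θ 𝒳 : Type*} [MeasurableSpace Ω] [MeasurableSpace Θ] [MeasurableSpace 𝒳] {K : ℕ}

/-- The conditional law of the binary loss given parameter, context and action:
`true` (loss `1`) with probability `meanLoss θ x a`, and `false` (loss `0`) otherwise. -/
noncomputable def BernoulliBandit.lossKernel (M : BernoulliBandit Θ 𝒳 K) :
    Kernel (Θ × 𝒳 × Fin K) Bool where
  toFun p := bernoulliMeasure true false (M.meanLoss p.1 p.2.1 p.2.2)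
  measurable' := by
    classical
    refine Measure.measurable_of_measurable_coe _ fun s hs => ?_
    have h := M.measurable_meanLoss
    have h1 : Measurable fun p : Θ × 𝒳 × Fin K =>
        ((unitInterval.toNNReal (M.meanLoss p.1 p.2.1 p.2.2) : NNReal) : ENNReal) :=
      (measurable_subtype_coe.comp h).subtype_mk.coe_nnreal_ennreal
    have h2 : Measurable fun p : Θ × 𝒳 × Fin K =>
        ((unitInterval.toNNReal (unitInterval.symm (M.meanLoss p.1 p.2.1 p.2.2)) : NNReal) :
          ENNReal) :=
      (measurable_subtype_coe.comp
        (unitInterval.continuous_symm.measurable.comp h)).subtype_mk.coe_nnreal_ennreal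
    simp only [bernoulliMeasure_apply _ hs]
    split_ifs <;> first | exact measurable_const | exact h1 | exact h2

instance (M : BernoulliBandit Θ 𝒳 K) : IsMarkovKernel M.lossKernel :=
  ⟨fun p => ⟨bernoulliMeasure_apply_of_mem_of_mem (x := true) (y := false)
    (M.meanLoss p.1 p.2.1 p.2.2) MeasurableSet.univ (Set.mem_univ _) (Set.mem_univ _)⟩⟩

/-- `act θ x` is a (measurable) choice of `argmin_a meanLoss θ x a`; ties are broken
arbitrarily. -/
structure BernoulliBandit.IsArgmin (M : BernoulliBandit Θ 𝒳 K) (act : Θ → 𝒳 → Fin K) : Prop where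
  measurable : Measurable fun p : Θ × 𝒳 => act p.1 p.2
  le : ∀ θ x a, M.meanLoss θ x (act θ x) ≤ M.meanLoss θ x a

/-- The possible observed histories (context, action, loss) of the first `t` rounds. -/
abbrev History (𝒳 : Type*) (K t : ℕ) : Type _ := Fin t → 𝒳 × Fin K × Bool

/-- The observed history before round `t`. Rounds are numbered `0, 1, 2, …`. -/
def history (X : ℕ → Ω → 𝒳) (A : ℕ → Ω → Fin K) (L : ℕ → Ω → Bool) (t : ℕ) (ω : Ω) :
    History 𝒳 K t :=
  fun s => (X s ω, A s ω, L s ω)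

/-- The posterior distribution: the regular conditional distribution of the unknown parameter
`θstar` given the observed history before round `t`. -/
noncomputable def posteriorDistrib [StandardBorelSpace Θ] [Nonempty Θ] (P : Measure Ω)
    [IsFiniteMeasure P] (θstar : Ω → Θ) (X : ℕ → Ω → 𝒳) (A : ℕ → Ω → Fin K) (L : ℕ → Ω → Bool)
    (t : ℕ) : Kernel (History 𝒳 K t) Θ :=
  condDistrib θstar (history X A L t) P

/-- The random variables `θstar` (true parameter), `X t` (contexts), `θ t` (sampled parameters),
`A t` (actions) and `L t` (losses) on the probability space `(Ω, P)` describe `T` rounds of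
interaction between Thompson sampling with prior `Q₁` and an adaptive randomized adversary who
selects the context of round `t` by the kernel `adv t`, which has access to the observed history
but not to `θstar`. -/
structure IsThompsonSampling [StandardBorelSpace Θ] [Nonempty Θ] (M : BernoulliBandit Θ 𝒳 K)
    (act : Θ → 𝒳 → Fin K) (Q₁ : Measure Θ) (adv : ∀ t, Kernel (History 𝒳 K t) 𝒳) (T : ℕ)
    (P : Measure Ω) [IsProbabilityMeasure P] (θstar : Ω → Θ) (X : ℕ → Ω → 𝒳) (θ : ℕ → Ω → Θ)
    (A : ℕ → Ω → Fin K) (L : ℕ → Ω → Bool) : Prop where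
  /-- `θstar` is drawn from the prior. -/
  prior : HasLaw θstar Q₁ P
  /-- Given `θstar` and the history, the adversary draws the context, ignoring `θstar`. -/
  context : ∀ t < T, HasCondDistrib (X t) (fun ω => (θstar ω, history X A L t ω))
    ((adv t).comap Prod.snd measurable_snd : Kernel (Θ × History 𝒳 K t) 𝒳) P
  /-- The agent samples a parameter from the posterior: given the history, the sample is
  independent of `θstar` and of the current context. -/
  sample : ∀ t < T, HasCondDistrib (θ t) (fun ω => (θstar ω, X t ω, history X A L t ω))
    ((posteriorDistrib P θstar X A L t).comap (fun p => p.2.2)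
      (measurable_snd.comp measurable_snd) : Kernel (Θ × 𝒳 × History 𝒳 K t) Θ) P
  /-- The agent plays a best action for the sampled parameter. -/
  action : ∀ t < T, ∀ᵐ ω ∂P, A t ω = act (θ t ω) (X t ω)
  /-- The loss is drawn from the loss distribution of the true parameter, the current context and
  the current action. -/
  loss : ∀ t < T, HasCondDistrib (L t)
    (fun ω => ((θstar ω, X t ω, A t ω), history X A L t ω))
    (M.lossKernel.comap Prod.fst measurable_fst :
      Kernel ((Θ × 𝒳 × Fin K) × History 𝒳 K t) Bool) P

/-- The Bayesian regret
`R_T = E[∑_{t < T} (ℓ(θstar, X_t, A_t) - ℓ(θstar, X_t, A⋆_t))]`, where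
`A⋆_t = argmin_a ℓ(θstar, X_t, a)`. -/
noncomputable def bayesRegret (M : BernoulliBandit Θ 𝒳 K) (act : Θ → 𝒳 → Fin K) (T : ℕ)
    (P : Measure Ω) (θstar : Ω → Θ) (X : ℕ → Ω → 𝒳) (A : ℕ → Ω → Fin K) : ℝ :=
  ∫ ω, ∑ t ∈ Finset.range T, ((M.meanLoss (θstar ω) (X t ω) (A t ω) : ℝ) -
    (M.meanLoss (θstar ω) (X t ω) (act (θstar ω) (X t ω)) : ℝ)) ∂P

end

end ContextualBandit

/-!
The information-theoretic analysis of Thompson sampling, with the mutual information replaced by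
the logarithmic loss of an explicit forecaster.

Fix for each round a forecast `q (H, X, a)` of the loss. Given the history and the context, the
sampled parameter is an independent copy of the true one, so `q` has the same mean at the played
action as at the optimal action, and the regret of the round is the sum of the means of
`ℓ(θ⋆, X, A) - q(A)` and of `q(A⋆) - ℓ(θ⋆, X, A⋆)`. The first is at most the root of the mean
squared error `E[(ℓ(θ⋆, X, A) - q(A))²]`. In the second the action depends on the parameter;
decoupling the two costs a factor `K` under the root
(`integral_le_add_integral_sq_indep`). Both estimates are kept in the linear form
`K / (2 λ) + λ / 2 * error`, which can be integrated and summed over rounds, with `λ` chosen at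
the very end (`IsThompsonSampling.regret_round_le`).

By Pinsker's inequality, twice the squared error is at most the excess expected logarithmic loss
of `q` over that of the true parameter (`IsThompsonSampling.integral_sq_le_integral_log`). For `q`
the Bayes mixture over a finite set `F` of parameters, the cumulative logarithmic loss telescopes:
for every realization, the excess is at most `log #F` plus the log-likelihood gap between the true
parameter and the closest member of `F` (`sum_log_sub_log_mixForecast_le`). The log-likelihood of a
logistic loss is `1`-Lipschitz in the logit, so that a cover of the ball of radius `S` at scale
`1 / (B T)` makes the gap at most `1`; by volume comparison `(2 S B T + 1) ^ d` points suffice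
(`exists_cover_ball_scaled`). Hence twice the total squared error is at most
`d log (2 S B T + 1) + 1`, and optimizing `λ` gives the bound.
-/

namespace ContextualBandit

/-! ### Bernoulli likelihoods -/

/-- The probability of the outcome `b` under the Bernoulli distribution with parameter `p`. -/
noncomputable def bernLik (p : ℝ) (b : Bool) : ℝ := if b then p else 1 - p

lemma le_bernLik {c p : ℝ} (hp : p ∈ Set.Icc c (1 - c)) (b : Bool) : c ≤ bernLik p b := by
  cases b <;> simp [bernLik] <;> linarith [hp.1, hp.2]

lemma bernLik_le_one {p : ℝ} (hp : p ∈ Set.Icc (0 : ℝ) 1) (b : Bool) : bernLik p b ≤ 1 := by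
  cases b <;> simp [bernLik] <;> linarith [hp.1, hp.2]

@[fun_prop]
lemma measurable_bernLik : Measurable fun z : ℝ × Bool => bernLik z.1 z.2 := by
  refine measurable_from_prod_countable_left fun b => ?_
  cases b <;> simp [bernLik] <;> fun_prop

/-- Pinsker's inequality for Bernoulli distributions, when the mean of the first one is the
smaller. -/
lemma two_mul_sub_sq_le_bernoulli_kl_of_le {p q : ℝ} (hp : 0 < p) (hpq : p ≤ q) (hq : q < 1) :
    2 * (p - q) ^ 2 ≤ p * (Real.log p - Real.log q)
      + (1 - p) * (Real.log (1 - p) - Real.log (1 - q)) := by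
  -- The difference of the two sides vanishes at `q = p` and is nondecreasing in `q ≥ p`, with
  -- derivative `(q - p) * (1 / (q * (1 - q)) - 4)`.
  let f : ℝ → ℝ := fun q => p * (Real.log p - Real.log q)
      + (1 - p) * (Real.log (1 - p) - Real.log (1 - q)) - 2 * (p - q) ^ 2
  have hd : ∀ x ∈ Set.Icc p q, HasDerivAt f
      (p * (0 - x⁻¹) + (1 - p) * (0 - (1 - x)⁻¹ * (-1)) - 2 * (2 * (p - x) * (-1))) x := by
    intro x hx
    have hx0 : x ≠ 0 := (hp.trans_le hx.1).ne'
    have hx1 : 1 - x ≠ 0 := by linarith [hx.2]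
    have h1 : HasDerivAt (fun y : ℝ => 1 - y) (-1) x := by
      simpa using (hasDerivAt_id x).const_sub 1
    have h2 : HasDerivAt (fun y : ℝ => p - y) (-1) x := by
      simpa using (hasDerivAt_id x).const_sub p
    have h3 := ((Real.hasDerivAt_log hx0).const_sub (Real.log p)).const_mul p
    have h4 := (((Real.hasDerivAt_log hx1).comp x h1).const_sub (Real.log (1 - p))).const_mul (1 - p)
    have h5 := (h2.pow 2).const_mul 2
    refine ((h3.add h4).sub h5).congr_deriv ?_
    simp
  have hmono : MonotoneOn f (Set.Icc p q) := by
    refine monotoneOn_of_deriv_nonneg (convex_Icc p q)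
      (fun x hx => (hd x hx).continuousAt.continuousWithinAt)
      (fun x hx => (hd x (interior_subset hx)).differentiableAt.differentiableWithinAt) ?_
    intro x hx
    have hx' := interior_subset hx
    rw [(hd x hx').deriv]
    have hx0 : 0 < x := hp.trans_le hx'.1
    have hx1 : 0 < 1 - x := by linarith [hx'.2]
    have : p * (0 - x⁻¹) + (1 - p) * (0 - (1 - x)⁻¹ * (-1)) - 2 * (2 * (p - x) * (-1))
        = (x - p) * (2 * x - 1) ^ 2 / (x * (1 - x)) := by
      field_simp
      ring
    rw [this]
    have := hx'.1
    have : 0 ≤ x - p := by linarith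
    positivity
  have h := hmono (Set.left_mem_Icc.2 hpq) (Set.right_mem_Icc.2 hpq) hpq
  simp only [f, sub_self, mul_zero, add_zero] at h
  linarith

/-- Pinsker's inequality for Bernoulli distributions. -/
lemma two_mul_sub_sq_le_bernoulli_kl {p q : ℝ} (hp : p ∈ Set.Ioo (0 : ℝ) 1)
    (hq : q ∈ Set.Ioo (0 : ℝ) 1) :
    2 * (p - q) ^ 2 ≤ p * (Real.log p - Real.log q)
      + (1 - p) * (Real.log (1 - p) - Real.log (1 - q)) := by
  rcases le_total p q with h | h
  · exact two_mul_sub_sq_le_bernoulli_kl_of_le hp.1 h hq.2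
  · have := two_mul_sub_sq_le_bernoulli_kl_of_le (p := 1 - p) (q := 1 - q)
      (by linarith [hp.2]) (by linarith) (by linarith [hq.1])
    rw [sub_sub_cancel, sub_sub_cancel] at this
    nlinarith

/-! ### Logistic losses -/

/-- The logarithm of the sigmoid function is `1`-Lipschitz, in exponentiated form. -/
lemma sigmoid_le_exp_mul_sigmoid {z w δ : ℝ} (h : |z - w| ≤ δ) :
    Real.sigmoid z ≤ Real.exp δ * Real.sigmoid w := by
  have h1 : Real.exp (-w) ≤ Real.exp δ * Real.exp (-z) := by
    rw [← Real.exp_add]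
    exact Real.exp_le_exp.2 (by linarith [le_abs_self (z - w)])
  have h2 : 1 ≤ Real.exp δ := Real.one_le_exp ((abs_nonneg _).trans h)
  have hz := Real.exp_pos (-z)
  have hw := Real.exp_pos (-w)
  rw [Real.sigmoid_def, Real.sigmoid_def, ← div_eq_mul_inv, inv_eq_one_div,
    div_le_div_iff₀ (by positivity) (by positivity)]
  nlinarith

lemma log_bernLik_sigmoid_le {z w δ : ℝ} (h : |z - w| ≤ δ) (b : Bool) :
    Real.log (bernLik (Real.sigmoid z) b) ≤ Real.log (bernLik (Real.sigmoid w) b) + δ := by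
  have key : ∀ z w : ℝ, |z - w| ≤ δ →
      Real.log (Real.sigmoid z) ≤ Real.log (Real.sigmoid w) + δ := by
    intro z w h
    have := Real.log_le_log (Real.sigmoid_pos z) (sigmoid_le_exp_mul_sigmoid h)
    rw [Real.log_mul (Real.exp_pos _).ne' (Real.sigmoid_pos w).ne', Real.log_exp] at this
    linarith
  cases b
  · simp only [bernLik, Bool.false_eq_true, if_false, ← Real.sigmoid_neg]
    refine key _ _ ?_
    rw [abs_sub_comm] at h
    convert h using 2
    ring
  · simpa [bernLik] using key z w h

lemma sigmoid_mem_Icc {z r : ℝ} (h : |z| ≤ r) :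
    Real.sigmoid z ∈ Set.Icc (Real.sigmoid (-r)) (1 - Real.sigmoid (-r)) := by
  rw [← Real.sigmoid_neg, neg_neg]
  exact ⟨Real.sigmoid_le (abs_le.1 h).1, Real.sigmoid_le (abs_le.1 h).2⟩

/-! ### Covering Euclidean balls -/

open Metric in
/-- The volume bound for separated sets: balls of radius `ε / 2` around the points are disjoint
and contained in the ball of radius `S + ε / 2`. -/
lemma card_le_of_separated_in_ball {d : ℕ} {S ε : ℝ} (hS : 0 ≤ S) (hε : 0 < ε)
    (s : Finset (EuclideanSpace ℝ (Fin d))) (hs : ∀ c ∈ s, ‖c‖ ≤ S)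
    (h : ∀ c ∈ s, ∀ c' ∈ s, c ≠ c' → ε < ‖c - c'‖) : (s.card : ℝ) ≤ (2 * S / ε + 1) ^ d := by
  let μ : Measure (EuclideanSpace ℝ (Fin d)) := volume
  have hρ : 0 < S + ε / 2 := by positivity
  have D : (s : Set (EuclideanSpace ℝ (Fin d))).PairwiseDisjoint (fun c => ball c (ε / 2)) := by
    intro c hc c' hc' hcc
    refine ball_disjoint_ball ?_
    rw [dist_eq_norm]
    linarith [h c hc c' hc' hcc]
  have hsub : (⋃ c ∈ s, ball c (ε / 2)) ⊆ ball (0 : EuclideanSpace ℝ (Fin d)) (S + ε / 2) := by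
    refine Set.iUnion₂_subset fun c hc => ball_subset_ball' ?_
    rw [dist_zero_right]
    linarith [hs c hc]
  have hle := measure_mono (μ := μ) hsub
  rw [measure_biUnion_finset D fun c _ => measurableSet_ball] at hle
  simp only [μ.addHaar_ball_of_pos _ (half_pos hε), μ.addHaar_ball_of_pos _ hρ, Finset.sum_const,
    nsmul_eq_mul, finrank_euclideanSpace_fin, ← mul_assoc] at hle
  have hle' := (ENNReal.mul_le_mul_iff_left (measure_ball_pos μ _ zero_lt_one).ne'
    measure_ball_lt_top.ne).1 hle
  have h3 := ENNReal.toReal_le_of_le_ofReal (by positivity) hle'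
  rw [ENNReal.toReal_mul, ENNReal.toReal_ofReal (by positivity), ENNReal.toReal_natCast] at h3
  have : (2 * S / ε + 1) ^ d = (S + ε / 2) ^ d / (ε / 2) ^ d := by
    rw [← div_pow]
    congr 1
    field_simp
  rw [this, le_div_iff₀ (by positivity)]
  exact h3

/-- A maximal `ε`-separated subset of the ball of radius `S` is an `ε`-cover. -/
lemma exists_cover_ball {d : ℕ} {S ε : ℝ} (hS : 0 ≤ S) (hε : 0 < ε) :
    ∃ F : Finset (EuclideanSpace ℝ (Fin d)), F.Nonempty ∧ (∀ c ∈ F, ‖c‖ ≤ S) ∧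
      (F.card : ℝ) ≤ (2 * S / ε + 1) ^ d ∧ ∀ θ, ‖θ‖ ≤ S → ∃ c ∈ F, ‖θ - c‖ ≤ ε := by
  classical
  let p : Finset (EuclideanSpace ℝ (Fin d)) → Prop := fun s =>
    (∀ c ∈ s, ‖c‖ ≤ S) ∧ ∀ c ∈ s, ∀ c' ∈ s, c ≠ c' → ε < ‖c - c'‖
  have hb : ∀ n, (∃ s, p s ∧ s.card = n) → n ≤ ⌊(2 * S / ε + 1) ^ d⌋₊ := by
    rintro n ⟨s, hs, rfl⟩
    exact Nat.le_floor (card_le_of_separated_in_ball hS hε s hs.1 hs.2)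
  have h0 : ∃ s, p s ∧ s.card = 0 := ⟨∅, by simp [p], rfl⟩
  obtain ⟨F, hF, hcard⟩ := Nat.findGreatest_spec (P := fun n => ∃ s, p s ∧ s.card = n)
    (hb 0 h0) h0
  have hmax : ∀ s, p s → s.card ≤ F.card := fun s hs =>
    hcard ▸ Nat.le_findGreatest (hb _ ⟨s, hs, rfl⟩) ⟨s, hs, rfl⟩
  have hcov : ∀ θ, ‖θ‖ ≤ S → ∃ c ∈ F, ‖θ - c‖ ≤ ε := by
    intro θ hθ
    by_contra! hcon
    have hnot : θ ∉ F := fun hmem => by simpa using (hε.trans (hcon θ hmem))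
    have := hmax (insert θ F) ⟨by
      intro c hc
      rcases Finset.mem_insert.1 hc with rfl | hc
      exacts [hθ, hF.1 c hc], by
      intro c hc c' hc' hne
      rcases Finset.mem_insert.1 hc with h1 | h1 <;> rcases Finset.mem_insert.1 hc' with h2 | h2
      · exact absurd (h1.trans h2.symm) hne
      · exact h1 ▸ hcon c' h2
      · rw [norm_sub_rev]
        exact h2 ▸ hcon c h1
      · exact hF.2 c h1 c' h2 hne⟩
    rw [Finset.card_insert_of_notMem hnot] at this
    lia
  refine ⟨F, ?_, hF.1, card_le_of_separated_in_ball hS hε F hF.1 hF.2, hcov⟩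
  obtain ⟨c, hc, -⟩ := hcov 0 (by simpa using hS)
  exact ⟨c, hc⟩

/-- A cover of the ball of radius `S` at scale `1 / r`, in a form that includes `r = 0`, where a
single point suffices. -/
lemma exists_cover_ball_scaled {d : ℕ} {S r : ℝ} (hS : 0 ≤ S) (hr : 0 ≤ r) :
    ∃ F : Finset (EuclideanSpace ℝ (Fin d)), F.Nonempty ∧ (∀ c ∈ F, ‖c‖ ≤ S) ∧
      (F.card : ℝ) ≤ (2 * S * r + 1) ^ d ∧ ∀ θ, ‖θ‖ ≤ S → ∃ c ∈ F, r * ‖θ - c‖ ≤ 1 := by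
  rcases hr.eq_or_lt with rfl | hr
  · exact ⟨{0}, by simp, by simpa using hS, by simp, fun θ _ => ⟨0, by simp⟩⟩
  · obtain ⟨F, h1, h2, h3, h4⟩ := exists_cover_ball (d := d) hS (inv_pos.2 hr)
    refine ⟨F, h1, h2, by simpa [div_inv_eq_mul] using h3, fun θ hθ => ?_⟩
    obtain ⟨c, hc, hle⟩ := h4 θ hθ
    refine ⟨c, hc, ?_⟩
    calc r * ‖θ - c‖ ≤ r * r⁻¹ := by gcongr
      _ = 1 := mul_inv_cancel₀ hr.ne'

/-! ### The order of magnitude of the bound -/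

lemma sqrt_regretBound_le {d K T : ℕ} {S B : ℝ} (hd : 1 ≤ d) (hS : 0 ≤ S) (hB : 0 ≤ B) :
    √(2 * K * T * (d * Real.log (2 * S * B * T + 1) + 1))
      ≤ 4 * √(d * K * T) * Real.log (2 + S * B * T) ^ 1 := by
  set y : ℝ := S * B * T with hy
  have hy0 : 0 ≤ y := by positivity
  have hd' : (1 : ℝ) ≤ d := by exact_mod_cast hd
  have h1 : Real.log (2 * S * B * T + 1) ≤ 2 * Real.log (2 + y) := by
    have : (2 : ℝ) * Real.log (2 + y) = Real.log ((2 + y) ^ 2) := by simp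
    rw [this]
    refine Real.log_le_log (by positivity) ?_
    have : 2 * S * B * T = 2 * y := by rw [hy]; ring
    rw [this]
    nlinarith
  have h2 : (1 : ℝ) / 2 ≤ Real.log (2 + y) := by
    have := Real.log_le_log (by norm_num : (0 : ℝ) < 2) (by linarith : (2 : ℝ) ≤ 2 + y)
    linarith [Real.log_two_gt_d9]
  set l := Real.log (2 + y)
  rw [pow_one]
  refine Real.sqrt_le_iff.2 ⟨by positivity, ?_⟩
  rw [mul_pow, mul_pow, Real.sq_sqrt (by positivity)]
  calc 2 * K * T * (d * Real.log (2 * S * B * T + 1) + 1)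
      ≤ 2 * K * T * (d * (2 * l) + d * (2 * l)) := by gcongr; nlinarith
    _ = (d * K * T) * (8 * l) := by ring
    _ ≤ (d * K * T) * (16 * l ^ 2) := mul_le_mul_of_nonneg_left (by nlinarith) (by positivity)
    _ = 4 ^ 2 * (d * K * T) * l ^ 2 := by ring


/-! ### Decoupling the action from the parameter -/

section Decoupling

variable {Θ : Type*} [MeasurableSpace Θ] {K : ℕ}

lemma integrable_of_bound {α : Type*} [MeasurableSpace α] {μ : Measure α} [IsFiniteMeasure μ]
    {f : α → ℝ} (hf : AEMeasurable f μ) (C : ℝ) (h : ∀ x, |f x| ≤ C) : Integrable f μ :=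
  .of_bound hf.aestronglyMeasurable C (.of_forall h)

/-- If `θ, θ'` are independent with law `Q`, then the mean of `u θ (a θ)`, where the action is
optimal for the parameter, is controlled by the second moment of `u θ (a θ')`, where it is
independent of it. For each action `b` of probability `π > 0` one integrates
`u ≤ 1 / (2 λ π) + λ π u ^ 2 / 2` over `{a = b}`. -/
lemma integral_le_add_integral_sq_indep (Q : Measure Θ) [IsProbabilityMeasure Q] {a : Θ → Fin K}
    (ha : Measurable a) {u : Θ → Fin K → ℝ} (hu : ∀ b, Measurable fun θ => u θ b)
    (hub : ∀ θ b, |u θ b| ≤ 1) {l : ℝ} (hl : 0 < l) :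
    ∫ θ, u θ (a θ) ∂Q ≤ K / (2 * l) + l / 2 * ∫ z, u z.1 (a z.2) ^ 2 ∂(Q.prod Q) := by
  classical
  have hs : ∀ b, MeasurableSet (a ⁻¹' {b}) := fun b => ha (measurableSet_singleton b)
  have hI : ∀ b, Integrable (fun θ => u θ b) Q := fun b =>
    integrable_of_bound (hu b).aemeasurable 1 (hub · b)
  have hI2 : ∀ b, Integrable (fun θ => u θ b ^ 2) Q := fun b =>
    integrable_of_bound ((hu b).pow_const 2).aemeasurable 1 fun θ => by
      rw [abs_of_nonneg (sq_nonneg _), ← sq_abs]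
      exact pow_le_one₀ (abs_nonneg _) (hub θ b)
  have hL : ∫ θ, u θ (a θ) ∂Q = ∑ b, ∫ θ in a ⁻¹' {b}, u θ b ∂Q := by
    simp_rw [← integral_indicator (hs _)]
    rw [← integral_finsetSum _ fun b _ => (hI b).indicator (hs b)]
    refine integral_congr_ae (.of_forall fun θ => ?_)
    simp [Set.indicator_apply]
  have hR : ∫ z, u z.1 (a z.2) ^ 2 ∂(Q.prod Q)
      = ∑ b, Q.real (a ⁻¹' {b}) * ∫ θ, u θ b ^ 2 ∂Q := by
    have : ∀ z : Θ × Θ, u z.1 (a z.2) ^ 2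
        = ∑ b, u z.1 b ^ 2 * (a ⁻¹' {b}).indicator (fun _ => (1 : ℝ)) z.2 := by
      intro z
      simp [Set.indicator_apply]
    simp_rw [this]
    rw [integral_finsetSum _ fun b _ =>
      (hI2 b).mul_prod ((integrable_const (1 : ℝ)).indicator (hs b))]
    refine Finset.sum_congr rfl fun b _ => ?_
    rw [integral_prod_mul (fun θ => u θ b ^ 2) ((a ⁻¹' {b}).indicator fun _ => (1 : ℝ)),
      integral_indicator_const _ (hs b), smul_eq_mul, mul_one, mul_comm]
  have hb : ∀ b, ∫ θ in a ⁻¹' {b}, u θ b ∂Q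
      ≤ 1 / (2 * l) + l / 2 * (Q.real (a ⁻¹' {b}) * ∫ θ, u θ b ^ 2 ∂Q) := by
    intro b
    have hnn : 0 ≤ ∫ θ, u θ b ^ 2 ∂Q := integral_nonneg fun θ => sq_nonneg _
    set π := Q.real (a ⁻¹' {b}) with hπ
    have hπ0 : 0 ≤ π := measureReal_nonneg
    -- On an action of probability zero the weight `1 / (2 λ π)` is not available, but the left-hand
    -- side vanishes.
    rcases hπ0.eq_or_lt with h0 | h0
    · have : Q (a ⁻¹' {b}) = 0 := (measureReal_eq_zero_iff).1 (hπ ▸ h0.symm)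
      rw [Measure.restrict_eq_zero.2 this, integral_zero_measure, ← h0]
      positivity
    · calc ∫ θ in a ⁻¹' {b}, u θ b ∂Q
          ≤ ∫ θ in a ⁻¹' {b}, (1 / (2 * l * π) + l * π / 2 * u θ b ^ 2) ∂Q := by
            refine integral_mono (hI b).integrableOn
              ((integrable_const _).add ((hI2 b).integrableOn.const_mul _)) fun θ => ?_
            have h1 : u θ b * (2 * (l * π)) ≤ 1 + (l * π) ^ 2 * u θ b ^ 2 := by
              nlinarith [sq_nonneg (1 - l * π * u θ b)]
            have h2 : 1 / (2 * l * π) + l * π / 2 * u θ b ^ 2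
                = (1 + (l * π) ^ 2 * u θ b ^ 2) / (2 * (l * π)) := by field_simp
            simp only [h2]
            rwa [le_div_iff₀ (by positivity)]
        _ = π * (1 / (2 * l * π)) + l * π / 2 * ∫ θ in a ⁻¹' {b}, u θ b ^ 2 ∂Q := by
            rw [integral_add (integrable_const _) ((hI2 b).integrableOn.const_mul _),
              integral_const_mul, setIntegral_const, smul_eq_mul]
        _ ≤ 1 / (2 * l) + l * π / 2 * ∫ θ, u θ b ^ 2 ∂Q := by
            have h1 : π * (1 / (2 * l * π)) = 1 / (2 * l) := by field_simp
            rw [h1]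
            have := setIntegral_le_integral (s := a ⁻¹' {b}) (hI2 b)
              (.of_forall fun θ => sq_nonneg (u θ b))
            gcongr
        _ = _ := by ring
  rw [hL, hR, Finset.mul_sum]
  refine (Finset.sum_le_sum fun b _ => hb b).trans_eq ?_
  rw [Finset.sum_add_distrib]
  simp [div_eq_mul_inv]

/-- The regret of playing the optimal action of an independent copy `θ'` of the parameter `θ`,
compared with the mean squared error of an arbitrary forecast `q` of the losses. The forecast
drops out of the left-hand side, as `q (a θ)` and `q (a θ')` have the same mean. -/
lemma integral_sub_le_add_integral_sq_indep (Q : Measure Θ) [IsProbabilityMeasure Q]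
    {a : Θ → Fin K} (ha : Measurable a) {f : Θ → Fin K → ℝ}
    (hf : ∀ b, Measurable fun θ => f θ b) (hfb : ∀ θ b, f θ b ∈ Set.Icc (0 : ℝ) 1)
    {q : Fin K → ℝ} (hq : ∀ b, q b ∈ Set.Icc (0 : ℝ) 1) {l : ℝ} (hl : 0 < l) :
    ∫ z, (f z.1 (a z.2) - f z.1 (a z.1)) ∂(Q.prod Q)
      ≤ K / l + l * ∫ z, (f z.1 (a z.2) - q (a z.2)) ^ 2 ∂(Q.prod Q) := by
  have hfm : Measurable fun z : Θ × Fin K => f z.1 z.2 := measurable_from_prod_countable_left hf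
  have hqm : Measurable q := measurable_of_finite q
  have hK : (1 : ℝ) ≤ K := by
    obtain ⟨θ⟩ : Nonempty Θ := Q.nonempty_of_neZero
    exact_mod_cast (Nat.succ_le_of_lt (a θ).pos)
  have m1 : Measurable fun z : Θ × Θ => f z.1 (a z.2) :=
    hfm.comp (measurable_fst.prodMk (ha.comp measurable_snd))
  have m2 : Measurable fun θ : Θ => f θ (a θ) := hfm.comp (measurable_id.prodMk ha)
  have habs : ∀ θ b c, |f θ b - q c| ≤ 1 := fun θ b c => by
    rw [abs_le]
    constructor <;> linarith [(hfb θ b).1, (hfb θ b).2, (hq c).1, (hq c).2]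
  have i1 : Integrable (fun z : Θ × Θ => f z.1 (a z.2) - q (a z.2)) (Q.prod Q) :=
    integrable_of_bound (m1.sub (hqm.comp (ha.comp measurable_snd))).aemeasurable 1
      fun z => habs _ _ _
  have i1' : Integrable (fun z : Θ × Θ => (f z.1 (a z.2) - q (a z.2)) ^ 2) (Q.prod Q) :=
    integrable_of_bound ((m1.sub (hqm.comp (ha.comp measurable_snd))).pow_const 2).aemeasurable 1
      fun z => by
        rw [abs_of_nonneg (sq_nonneg _), ← sq_abs]
        exact pow_le_one₀ (abs_nonneg _) (habs _ _ _)
  have iq : Integrable (fun θ : Θ => q (a θ)) Q :=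
    integrable_of_bound (hqm.comp ha).aemeasurable 1 fun θ => by
      rw [abs_of_nonneg (hq _).1]; exact (hq _).2
  have iopt : Integrable (fun θ : Θ => f θ (a θ)) Q :=
    integrable_of_bound m2.aemeasurable 1 fun θ => by
      rw [abs_of_nonneg (hfb _ _).1]; exact (hfb _ _).2
  have hsplit : ∫ z, (f z.1 (a z.2) - f z.1 (a z.1)) ∂(Q.prod Q)
      = ∫ z, (f z.1 (a z.2) - q (a z.2)) ∂(Q.prod Q) + ∫ θ, (q (a θ) - f θ (a θ)) ∂Q := by
    have e1 : ∀ z : Θ × Θ, f z.1 (a z.2) - f z.1 (a z.1)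
        = (f z.1 (a z.2) - q (a z.2)) + (q (a z.2) - f z.1 (a z.1)) := fun z => by ring
    simp_rw [e1]
    have i2 : Integrable (fun z : Θ × Θ => q (a z.2) - f z.1 (a z.1)) (Q.prod Q) :=
      (iq.comp_snd Q).sub (iopt.comp_fst Q)
    rw [integral_add i1 i2,
      integral_sub (iq.comp_snd Q) (iopt.comp_fst Q), integral_sub iq iopt,
      integral_fun_snd (fun θ => q (a θ)), integral_fun_fst (fun θ => f θ (a θ))]
    simp
  have h1 : ∫ z, (f z.1 (a z.2) - q (a z.2)) ∂(Q.prod Q)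
      ≤ 1 / (2 * l) + l / 2 * ∫ z, (f z.1 (a z.2) - q (a z.2)) ^ 2 ∂(Q.prod Q) := by
    calc _ ≤ ∫ z, (1 / (2 * l) + l / 2 * (f z.1 (a z.2) - q (a z.2)) ^ 2) ∂(Q.prod Q) := by
          refine integral_mono i1 ((integrable_const _).add (i1'.const_mul _)) fun z => ?_
          set v := f z.1 (a z.2) - q (a z.2)
          have h2 : 1 / (2 * l) + l / 2 * v ^ 2 = (1 + l ^ 2 * v ^ 2) / (2 * l) := by field_simp
          simp only [h2]
          rw [le_div_iff₀ (by positivity)]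
          nlinarith [sq_nonneg (1 - l * v)]
      _ = _ := by
          rw [integral_add (integrable_const _) (i1'.const_mul _), integral_const_mul]
          simp
  have h2 := integral_le_add_integral_sq_indep Q ha (u := fun θ b => q b - f θ b)
    (fun b => (hf b).const_sub (q b)) (fun θ b => by rw [abs_sub_comm]; exact habs _ _ _) hl
  have e2 : ∀ z : Θ × Θ, (q (a z.2) - f z.1 (a z.2)) ^ 2 = (f z.1 (a z.2) - q (a z.2)) ^ 2 :=
    fun z => by ring
  simp_rw [e2] at h2
  have h3 : 1 / (2 * l) ≤ K / (2 * l) := by gcongr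
  have h4 : (K : ℝ) / l = K / (2 * l) + K / (2 * l) := by field_simp; ring
  rw [hsplit, h4]
  linarith

end Decoupling

/-! ### The joint law of a round of Thompson sampling -/

section Law

variable {Ω Θ 𝒳 : Type*} [MeasurableSpace Ω] [MeasurableSpace Θ] [MeasurableSpace 𝒳] {K : ℕ}
  [StandardBorelSpace Θ] [Nonempty Θ] {M : BernoulliBandit Θ 𝒳 K} {act : Θ → 𝒳 → Fin K}
  {Q₁ : Measure Θ} {adv : ∀ t, Kernel (History 𝒳 K t) 𝒳} {T : ℕ} {P : Measure Ω}
  [IsProbabilityMeasure P] {θstar : Ω → Θ} {X : ℕ → Ω → 𝒳} {θ : ℕ → Ω → Θ}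
  {A : ℕ → Ω → Fin K} {L : ℕ → Ω → Bool}

instance (t : ℕ) : IsMarkovKernel (posteriorDistrib P θstar X A L t) := by
  unfold posteriorDistrib
  infer_instance

/-- Given the history and the context of a round, the true parameter and the sampled one are
independent and follow the posterior distribution. -/
lemma IsThompsonSampling.map_round [∀ t, IsMarkovKernel (adv t)]
    (h : IsThompsonSampling M act Q₁ adv T P θstar X θ A L) {t : ℕ} (ht : t < T) :
    P.map (fun ω => ((history X A L t ω, X t ω), (θstar ω, θ t ω)))
      = (P.map (history X A L t) ⊗ₘ adv t) ⊗ₘ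
        ((posteriorDistrib P θstar X A L t ×ₖ posteriorDistrib P θstar X A L t).comap Prod.fst
          measurable_fst) := by
  set H := history X A L t
  set Q := posteriorDistrib P θstar X A L t
  have hc := h.context t ht
  have hs := h.sample t ht
  have mS : AEMeasurable θstar P := h.prior.aemeasurable
  have mH : AEMeasurable H P := hc.aemeasurable_fst.snd
  have mX : AEMeasurable (X t) P := hc.aemeasurable_snd
  have mθ : AEMeasurable (θ t) P := hs.aemeasurable_snd
  refine Measure.ext_of_lintegral _ fun f hf => ?_
  have hpost : P.map (fun ω => (H ω, θstar ω)) = P.map H ⊗ₘ Q :=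
    (compProd_map_condDistrib mS).symm
  let g : Θ × 𝒳 × History 𝒳 K t → ENNReal :=
    fun p => ∫⁻ θ', f ((p.2.2, p.2.1), (p.1, θ')) ∂(Q p.2.2)
  have hg : Measurable g := by
    have : Measurable fun p : (Θ × 𝒳 × History 𝒳 K t) × Θ =>
      f ((p.1.2.2, p.1.2.1), (p.1.1, p.2)) := by fun_prop
    exact this.lintegral_kernel_prod_right'
      (κ := Q.comap (fun p : Θ × 𝒳 × History 𝒳 K t => p.2.2)
        (measurable_snd.comp measurable_snd))
  let g2 : History 𝒳 K t × Θ → ENNReal := fun p => ∫⁻ x, g (p.2, x, p.1) ∂(adv t p.1)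
  have hg2 : Measurable g2 := by
    have : Measurable fun p : (History 𝒳 K t × Θ) × 𝒳 => g (p.1.2, p.2, p.1.1) := by fun_prop
    exact this.lintegral_kernel_prod_right'
      (κ := (adv t).comap (fun p : History 𝒳 K t × Θ => p.1) measurable_fst)
  calc ∫⁻ z, f z ∂(P.map (fun ω => ((H ω, X t ω), (θstar ω, θ t ω))))
      = ∫⁻ ω, f ((H ω, X t ω), (θstar ω, θ t ω)) ∂P :=
        lintegral_map' hf.aemeasurable (by fun_prop)
    _ = ∫⁻ z, f ((z.1.2.2, z.1.2.1), (z.1.1, z.2))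
          ∂(P.map fun ω => ((θstar ω, X t ω, H ω), θ t ω)) :=
        (lintegral_map' (f := fun z : (Θ × 𝒳 × History 𝒳 K t) × Θ =>
          f ((z.1.2.2, z.1.2.1), (z.1.1, z.2))) (g := fun ω => ((θstar ω, X t ω, H ω), θ t ω))
          (by fun_prop) (by fun_prop)).symm
    _ = ∫⁻ p, g p ∂(P.map fun ω => (θstar ω, X t ω, H ω)) := by
        have : Measurable fun z : (Θ × 𝒳 × History 𝒳 K t) × Θ =>
            f ((z.1.2.2, z.1.2.1), (z.1.1, z.2)) := by fun_prop
        rw [hs.map_eq, Measure.lintegral_compProd this]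
        rfl
    _ = ∫⁻ ω, g (θstar ω, X t ω, H ω) ∂P := lintegral_map' hg.aemeasurable (by fun_prop)
    _ = ∫⁻ z, g (z.1.1, z.2, z.1.2) ∂(P.map fun ω => ((θstar ω, H ω), X t ω)) :=
        (lintegral_map' (f := fun z : (Θ × History 𝒳 K t) × 𝒳 => g (z.1.1, z.2, z.1.2))
          (g := fun ω => ((θstar ω, H ω), X t ω)) (by fun_prop) (by fun_prop)).symm
    _ = ∫⁻ p, g2 (p.2, p.1) ∂(P.map fun ω => (θstar ω, H ω)) := by
        have : Measurable fun z : (Θ × History 𝒳 K t) × 𝒳 => g (z.1.1, z.2, z.1.2) := by fun_prop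
        rw [hc.map_eq, Measure.lintegral_compProd this]
        rfl
    _ = ∫⁻ ω, g2 (H ω, θstar ω) ∂P :=
        lintegral_map' (f := fun p : Θ × History 𝒳 K t => g2 (p.2, p.1))
          (by fun_prop) (by fun_prop)
    _ = ∫⁻ p, g2 p ∂(P.map fun ω => (H ω, θstar ω)) :=
        (lintegral_map' hg2.aemeasurable (by fun_prop)).symm
    _ = ∫⁻ y, ∫⁻ s, ∫⁻ x, g (s, x, y) ∂(adv t y) ∂(Q y) ∂(P.map H) := by
        rw [hpost, Measure.lintegral_compProd hg2]
    _ = ∫⁻ y, ∫⁻ x, ∫⁻ s, g (s, x, y) ∂(Q y) ∂(adv t y) ∂(P.map H) := by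
        refine lintegral_congr fun y => lintegral_lintegral_swap ?_
        have : Measurable fun z : Θ × 𝒳 => g (z.1, z.2, y) := by fun_prop
        exact this.aemeasurable
    _ = _ := by
        rw [Measure.lintegral_compProd hf, Measure.lintegral_compProd]
        · refine lintegral_congr fun y => lintegral_congr fun x => ?_
          rw [Kernel.comap_apply, Kernel.prod_apply, lintegral_prod _ (by fun_prop)]
        · exact hf.lintegral_kernel_prod_right'

end Law


/-! ### Regret and prediction error -/

section Rounds

lemma BernoulliBandit.measurable_meanLoss_real {Θ 𝒳 : Type*} [MeasurableSpace Θ]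
    [MeasurableSpace 𝒳] {K : ℕ} (M : BernoulliBandit Θ 𝒳 K) :
    Measurable fun p : Θ × 𝒳 × Fin K => (M.meanLoss p.1 p.2.1 p.2.2 : ℝ) :=
  measurable_subtype_coe.comp M.measurable_meanLoss

lemma integrable_integral_of_measure_compProd {α β : Type*} [MeasurableSpace α]
    [MeasurableSpace β] {μ : Measure α} [SFinite μ] {κ : Kernel α β} [IsSFiniteKernel κ]
    {f : α × β → ℝ} (hf : Integrable f (μ ⊗ₘ κ)) : Integrable (fun x => ∫ y, f (x, y) ∂(κ x)) μ := by
  rw [Measure.compProd] at hf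
  simpa using hf.integral_compProd

variable {Ω Θ 𝒳 : Type*} [MeasurableSpace Ω] [MeasurableSpace Θ] [MeasurableSpace 𝒳] {K : ℕ}
  [StandardBorelSpace Θ] [Nonempty Θ] {M : BernoulliBandit Θ 𝒳 K} {act : Θ → 𝒳 → Fin K}
  {Q₁ : Measure Θ} {adv : ∀ t, Kernel (History 𝒳 K t) 𝒳} {T : ℕ} {P : Measure Ω}
  [IsProbabilityMeasure P] {θstar : Ω → Θ} {X : ℕ → Ω → 𝒳} {θ : ℕ → Ω → Θ}
  {A : ℕ → Ω → Fin K} {L : ℕ → Ω → Bool}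

/-- The regret of one round is controlled by the mean squared error of an arbitrary forecast `q`
of the loss from the history, the context and the action. -/
lemma IsThompsonSampling.regret_round_le [∀ t, IsMarkovKernel (adv t)]
    (h : IsThompsonSampling M act Q₁ adv T P θstar X θ A L) (hact : M.IsArgmin act) {t : ℕ}
    (ht : t < T) {q : History 𝒳 K t × 𝒳 × Fin K → ℝ} (hq : Measurable q)
    (hq01 : ∀ p, q p ∈ Set.Icc (0 : ℝ) 1) {l : ℝ} (hl : 0 < l) :
    ∫ ω, ((M.meanLoss (θstar ω) (X t ω) (A t ω) : ℝ) -
        M.meanLoss (θstar ω) (X t ω) (act (θstar ω) (X t ω))) ∂P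
      ≤ K / l + l * ∫ ω, ((M.meanLoss (θstar ω) (X t ω) (A t ω) : ℝ)
          - q (history X A L t ω, X t ω, A t ω)) ^ 2 ∂P := by
  set H := history X A L t
  set Q := posteriorDistrib P θstar X A L t
  have hM := M.measurable_meanLoss_real
  have ha := hact.measurable
  let G : (History 𝒳 K t × 𝒳) × (Θ × Θ) → ℝ := fun z =>
    (M.meanLoss z.2.1 z.1.2 (act z.2.2 z.1.2) : ℝ) - M.meanLoss z.2.1 z.1.2 (act z.2.1 z.1.2)
  let D : (History 𝒳 K t × 𝒳) × (Θ × Θ) → ℝ := fun z =>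
    ((M.meanLoss z.2.1 z.1.2 (act z.2.2 z.1.2) : ℝ) - q (z.1.1, z.1.2, act z.2.2 z.1.2)) ^ 2
  have ma2 : Measurable fun z : (History 𝒳 K t × 𝒳) × (Θ × Θ) => act z.2.2 z.1.2 :=
    ha.comp (f := fun z : (History 𝒳 K t × 𝒳) × (Θ × Θ) => (z.2.2, z.1.2)) (by fun_prop)
  have ma1 : Measurable fun z : (History 𝒳 K t × 𝒳) × (Θ × Θ) => act z.2.1 z.1.2 :=
    ha.comp (f := fun z : (History 𝒳 K t × 𝒳) × (Θ × Θ) => (z.2.1, z.1.2)) (by fun_prop)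
  have m2 : Measurable fun z : (History 𝒳 K t × 𝒳) × (Θ × Θ) =>
      (M.meanLoss z.2.1 z.1.2 (act z.2.2 z.1.2) : ℝ) :=
    hM.comp (f := fun z : (History 𝒳 K t × 𝒳) × (Θ × Θ) => (z.2.1, z.1.2, act z.2.2 z.1.2))
      (by fun_prop)
  have m1 : Measurable fun z : (History 𝒳 K t × 𝒳) × (Θ × Θ) =>
      (M.meanLoss z.2.1 z.1.2 (act z.2.1 z.1.2) : ℝ) :=
    hM.comp (f := fun z : (History 𝒳 K t × 𝒳) × (Θ × Θ) => (z.2.1, z.1.2, act z.2.1 z.1.2))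
      (by fun_prop)
  have mq : Measurable fun z : (History 𝒳 K t × 𝒳) × (Θ × Θ) =>
      q (z.1.1, z.1.2, act z.2.2 z.1.2) :=
    hq.comp (f := fun z : (History 𝒳 K t × 𝒳) × (Θ × Θ) => (z.1.1, z.1.2, act z.2.2 z.1.2))
      (by fun_prop)
  have mG : Measurable G := m2.sub m1
  have mD : Measurable D := (m2.sub mq).pow_const 2
  have bM : ∀ s x a, 0 ≤ (M.meanLoss s x a : ℝ) ∧ (M.meanLoss s x a : ℝ) ≤ 1 := fun s x a =>
    (M.meanLoss s x a).2
  have bG : ∀ z, |G z| ≤ 1 := fun z => by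
    simp only [G, abs_le]
    constructor <;> linarith [bM z.2.1 z.1.2 (act z.2.2 z.1.2), bM z.2.1 z.1.2 (act z.2.1 z.1.2)]
  have bD : ∀ z, |D z| ≤ 1 := fun z => by
    simp only [D]
    rw [abs_of_nonneg (sq_nonneg _), sq_le_one_iff_abs_le_one, abs_le]
    constructor <;> linarith [bM z.2.1 z.1.2 (act z.2.2 z.1.2),
      (hq01 (z.1.1, z.1.2, act z.2.2 z.1.2)).1,
      (hq01 (z.1.1, z.1.2, act z.2.2 z.1.2)).2]
  set κ := (Q ×ₖ Q).comap (Prod.fst : History 𝒳 K t × 𝒳 → History 𝒳 K t) measurable_fst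
  have mH : AEMeasurable H P := (h.context t ht).aemeasurable_fst.snd
  have mX : AEMeasurable (X t) P := (h.context t ht).aemeasurable_snd
  have mS : AEMeasurable θstar P := h.prior.aemeasurable
  have mθ : AEMeasurable (θ t) P := (h.sample t ht).aemeasurable_snd
  have : IsProbabilityMeasure (P.map H) := Measure.isProbabilityMeasure_map mH
  have hlaw := h.map_round ht
  have hJ : AEMeasurable (fun ω => ((H ω, X t ω), (θstar ω, θ t ω))) P := by fun_prop
  have key : ∀ F : (History 𝒳 K t × 𝒳) × (Θ × Θ) → ℝ, Measurable F → (∀ z, |F z| ≤ 1) →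
      ∫ ω, F ((H ω, X t ω), (θstar ω, θ t ω)) ∂P
        = ∫ p, ∫ z, F (p, z) ∂((Q p.1).prod (Q p.1)) ∂(P.map H ⊗ₘ adv t) := by
    intro F hF hb
    rw [← integral_map hJ hF.aestronglyMeasurable, hlaw,
      Measure.integral_compProd (integrable_of_bound hF.aemeasurable 1 hb)]
    simp_rw [Kernel.comap_apply, Kernel.prod_apply]
    rfl
  have kint : ∀ F : (History 𝒳 K t × 𝒳) × (Θ × Θ) → ℝ, Measurable F → (∀ z, |F z| ≤ 1) →
      Integrable (fun p => ∫ z, F (p, z) ∂((Q p.1).prod (Q p.1))) (P.map H ⊗ₘ adv t) := by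
    intro F hF hb
    have := integrable_integral_of_measure_compProd
      (integrable_of_bound (μ := (P.map H ⊗ₘ adv t) ⊗ₘ κ) hF.aemeasurable 1 hb)
    simpa only [κ, Kernel.comap_apply, Kernel.prod_apply] using this
  have e1 : ∫ ω, ((M.meanLoss (θstar ω) (X t ω) (A t ω) : ℝ) -
        M.meanLoss (θstar ω) (X t ω) (act (θstar ω) (X t ω))) ∂P
      = ∫ ω, G ((H ω, X t ω), (θstar ω, θ t ω)) ∂P := by
    refine integral_congr_ae ?_
    filter_upwards [h.action t ht] with ω hω
    simp only [G, hω]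
  have e2 : ∫ ω, ((M.meanLoss (θstar ω) (X t ω) (A t ω) : ℝ) - q (H ω, X t ω, A t ω)) ^ 2 ∂P
      = ∫ ω, D ((H ω, X t ω), (θstar ω, θ t ω)) ∂P := by
    refine integral_congr_ae ?_
    filter_upwards [h.action t ht] with ω hω
    simp only [D, hω]
  rw [e1, e2, key G mG bG, key D mD bD]
  calc _ ≤ ∫ p, (K / l + l * ∫ z, D (p, z) ∂((Q p.1).prod (Q p.1))) ∂(P.map H ⊗ₘ adv t) := by
        refine integral_mono (kint G mG bG)
          ((integrable_const _).add ((kint D mD bD).const_mul _)) fun p => ?_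
        exact integral_sub_le_add_integral_sq_indep (Q p.1) (a := fun s => act s p.2)
          (ha.comp (f := fun s : Θ => (s, p.2)) (by fun_prop))
          (f := fun s b => M.meanLoss s p.2 b)
          (fun b => hM.comp (f := fun s : Θ => (s, p.2, b)) (by fun_prop))
          (fun s b => (M.meanLoss s p.2 b).2) (q := fun b => q (p.1, p.2, b))
          (fun b => hq01 _) hl
    _ = _ := by
        rw [integral_add (integrable_const _) ((kint D mD bD).const_mul _), integral_const_mul]
        simp

/-- The mean squared error of a forecast is controlled by its excess logarithmic loss, by
Pinsker's inequality conditionally on the past. -/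
lemma IsThompsonSampling.integral_sq_le_integral_log
    (h : IsThompsonSampling M act Q₁ adv T P θstar X θ A L) {t : ℕ} (ht : t < T) {c : ℝ}
    (hc : 0 < c) (hM : ∀ᵐ ω ∂P, ∀ x a, (M.meanLoss (θstar ω) x a : ℝ) ∈ Set.Icc c (1 - c))
    {q : History 𝒳 K t × 𝒳 × Fin K → ℝ} (hq : Measurable q)
    (hqc : ∀ p, q p ∈ Set.Icc c (1 - c)) :
    Integrable (fun ω => Real.log (bernLik (M.meanLoss (θstar ω) (X t ω) (A t ω)) (L t ω))
        - Real.log (bernLik (q (history X A L t ω, X t ω, A t ω)) (L t ω))) P ∧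
    2 * ∫ ω, ((M.meanLoss (θstar ω) (X t ω) (A t ω) : ℝ)
          - q (history X A L t ω, X t ω, A t ω)) ^ 2 ∂P
      ≤ ∫ ω, (Real.log (bernLik (M.meanLoss (θstar ω) (X t ω) (A t ω)) (L t ω))
        - Real.log (bernLik (q (history X A L t ω, X t ω, A t ω)) (L t ω))) ∂P := by
  set H := history X A L t
  have hloss := h.loss t ht
  have mZ : AEMeasurable (fun ω => ((θstar ω, X t ω, A t ω), H ω)) P := hloss.aemeasurable_fst
  have mL : AEMeasurable (L t) P := hloss.aemeasurable_snd
  have mJ : AEMeasurable (fun ω => (((θstar ω, X t ω, A t ω), H ω), L t ω)) P := mZ.prodMk mL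
  let p : (Θ × 𝒳 × Fin K) × History 𝒳 K t → ℝ := fun z => M.meanLoss z.1.1 z.1.2.1 z.1.2.2
  let r : (Θ × 𝒳 × Fin K) × History 𝒳 K t → ℝ := fun z => q (z.2, z.1.2.1, z.1.2.2)
  have mp : Measurable p := M.measurable_meanLoss_real.comp measurable_fst
  have mr : Measurable r := hq.comp
    (f := fun z : (Θ × 𝒳 × Fin K) × History 𝒳 K t => (z.2, z.1.2.1, z.1.2.2)) (by fun_prop)
  let G : ((Θ × 𝒳 × Fin K) × History 𝒳 K t) × Bool → ℝ := fun z =>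
    Real.log (bernLik (p z.1) z.2) - Real.log (bernLik (r z.1) z.2)
  have mG : Measurable G := by
    refine Measurable.sub ?_ ?_
    · exact Real.measurable_log.comp (measurable_bernLik.comp
        (f := fun z : ((Θ × 𝒳 × Fin K) × History 𝒳 K t) × Bool => (p z.1, z.2)) (by fun_prop))
    · exact Real.measurable_log.comp (measurable_bernLik.comp
        (f := fun z : ((Θ × 𝒳 × Fin K) × History 𝒳 K t) × Bool => (r z.1, z.2)) (by fun_prop))
  have hlog : ∀ {v : ℝ} (b : Bool), v ∈ Set.Icc c (1 - c) →
      Real.log (bernLik v b) ∈ Set.Icc (Real.log c) 0 := by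
    intro v b hv
    have h1 := le_bernLik hv b
    exact ⟨Real.log_le_log hc h1, Real.log_nonpos (hc.le.trans h1)
      (bernLik_le_one ⟨hc.le.trans hv.1, by linarith [hv.2]⟩ b)⟩
  have hGi : Integrable (fun ω => G (((θstar ω, X t ω, A t ω), H ω), L t ω)) P := by
    refine .of_bound (mG.comp_aemeasurable mJ).aestronglyMeasurable (-Real.log c) ?_
    filter_upwards [hM] with ω hω
    have h1 := hlog (L t ω) (hω (X t ω) (A t ω))
    have h2 := hlog (L t ω) (hqc (H ω, X t ω, A t ω))
    simp only [G, p, r, Real.norm_eq_abs, abs_le]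
    constructor <;> linarith [h1.1, h1.2, h2.1, h2.2]
  refine ⟨hGi, ?_⟩
  let D : ((Θ × 𝒳 × Fin K) × History 𝒳 K t) → ℝ := fun z => 2 * (p z - r z) ^ 2
  have mD : Measurable D := ((mp.sub mr).pow_const 2).const_mul 2
  have hDi : Integrable (fun ω => D ((θstar ω, X t ω, A t ω), H ω)) P := by
    refine integrable_of_bound (mD.comp_aemeasurable mZ) 2 fun ω => ?_
    have h1 := (M.meanLoss (θstar ω) (X t ω) (A t ω)).2
    have h2 := hqc (H ω, X t ω, A t ω)
    simp only [D, p, r]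
    rw [abs_of_nonneg (by positivity)]
    have : ((M.meanLoss (θstar ω) (X t ω) (A t ω) : ℝ) - q (H ω, X t ω, A t ω)) ^ 2 ≤ 1 := by
      rw [sq_le_one_iff_abs_le_one, abs_le]
      constructor <;> linarith [h1.1, h1.2, h2.1, h2.2]
    linarith
  have hGi' : Integrable G (P.map (fun ω => (((θstar ω, X t ω, A t ω), H ω), L t ω))) :=
    (integrable_map_measure mG.aestronglyMeasurable mJ).2 hGi
  have eD : 2 * ∫ ω, ((M.meanLoss (θstar ω) (X t ω) (A t ω) : ℝ)
          - q (H ω, X t ω, A t ω)) ^ 2 ∂P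
      = ∫ z, D z ∂(P.map (fun ω => ((θstar ω, X t ω, A t ω), H ω))) := by
    rw [integral_map mZ mD.aestronglyMeasurable, ← integral_const_mul]
  have eG : ∫ ω, (Real.log (bernLik (M.meanLoss (θstar ω) (X t ω) (A t ω)) (L t ω))
        - Real.log (bernLik (q (H ω, X t ω, A t ω)) (L t ω))) ∂P
      = ∫ z, ∫ b, G (z, b) ∂(M.lossKernel z.1)
          ∂(P.map (fun ω => ((θstar ω, X t ω, A t ω), H ω))) := by
    rw [hloss.map_eq] at hGi'
    have := Measure.integral_compProd hGi'
    rw [← hloss.map_eq, integral_map mJ mG.aestronglyMeasurable] at this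
    exact this
  have hGi2 : Integrable (fun z => ∫ b, G (z, b) ∂(M.lossKernel z.1))
      (P.map (fun ω => ((θstar ω, X t ω, A t ω), H ω))) := by
    rw [hloss.map_eq] at hGi'
    exact integrable_integral_of_measure_compProd hGi'
  rw [eD, eG]
  refine integral_mono_ae ((integrable_map_measure mD.aestronglyMeasurable mZ).2 hDi) hGi2 ?_
  have hps : MeasurableSet {z : (Θ × 𝒳 × Fin K) × History 𝒳 K t | p z ∈ Set.Icc c (1 - c)} :=
    mp measurableSet_Icc
  have hae : ∀ᵐ z ∂(P.map (fun ω => ((θstar ω, X t ω, A t ω), H ω))),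
      p z ∈ Set.Icc c (1 - c) := by
    rw [ae_map_iff mZ hps]
    filter_upwards [hM] with ω hω using hω _ _
  filter_upwards [hae] with z hz
  have hrz : r z ∈ Set.Icc c (1 - c) := hqc _
  have := two_mul_sub_sq_le_bernoulli_kl (p := p z) (q := r z)
    ⟨hc.trans_le hz.1, by linarith [hz.2]⟩ ⟨hc.trans_le hrz.1, by linarith [hrz.2]⟩
  refine this.trans_eq ?_
  change _ = ∫ b, G (z, b) ∂(bernoulliMeasure true false (M.meanLoss z.1.1 z.1.2.1 z.1.2.2))
  rw [integral_bernoulliMeasure]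
  simp [G, bernLik, p]

end Rounds

/-! ### The Bayes mixture forecast -/

section Mixture

variable {Θ 𝒳 : Type*} [MeasurableSpace Θ] [MeasurableSpace 𝒳] {K : ℕ}

/-- The likelihood of the observed losses under the parameter `i`. -/
noncomputable def histLik (M : BernoulliBandit Θ 𝒳 K) {t : ℕ} (h : History 𝒳 K t) (i : Θ) : ℝ :=
  ∏ s, bernLik (M.meanLoss i (h s).1 (h s).2.1) (h s).2.2

/-- The Bayes forecast of the next loss under the uniform prior on the finite set `F`: the average
of the mean losses of the parameters in `F`, weighted by their likelihoods. -/
noncomputable def mixForecast (M : BernoulliBandit Θ 𝒳 K) (F : Finset Θ) {t : ℕ}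
    (p : History 𝒳 K t × 𝒳 × Fin K) : ℝ :=
  (∑ i ∈ F, histLik M p.1 i * M.meanLoss i p.2.1 p.2.2) / ∑ i ∈ F, histLik M p.1 i

variable {M : BernoulliBandit Θ 𝒳 K} {F : Finset Θ} {c : ℝ}

lemma histLik_pos {i : Θ} (hc : 0 < c)
    (hi : ∀ x a, (M.meanLoss i x a : ℝ) ∈ Set.Icc c (1 - c)) {t : ℕ} (h : History 𝒳 K t) :
    0 < histLik M h i :=
  Finset.prod_pos fun _ _ => hc.trans_le (le_bernLik (hi _ _) _)

lemma measurable_histLik (i : Θ) {t : ℕ} : Measurable fun h : History 𝒳 K t => histLik M h i := by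
  refine Finset.measurable_prod _ fun s _ => measurable_bernLik.comp
    (f := fun h : History 𝒳 K t => ((M.meanLoss i (h s).1 (h s).2.1 : ℝ), (h s).2.2)) ?_
  have : Measurable fun h : History 𝒳 K t => (M.meanLoss i (h s).1 (h s).2.1 : ℝ) :=
    M.measurable_meanLoss_real.comp
      (f := fun h : History 𝒳 K t => (i, (h s).1, (h s).2.1)) (by fun_prop)
  fun_prop

lemma measurable_mixForecast {t : ℕ} :
    Measurable (mixForecast M F : History 𝒳 K t × 𝒳 × Fin K → ℝ) := by
  have h1 : ∀ i, Measurable fun p : History 𝒳 K t × 𝒳 × Fin K => histLik M p.1 i := fun i =>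
    (measurable_histLik i).comp measurable_fst
  have h2 : ∀ i, Measurable fun p : History 𝒳 K t × 𝒳 × Fin K =>
      (M.meanLoss i p.2.1 p.2.2 : ℝ) := fun i =>
    M.measurable_meanLoss_real.comp
      (f := fun p : History 𝒳 K t × 𝒳 × Fin K => (i, p.2.1, p.2.2)) (by fun_prop)
  exact (Finset.measurable_fun_sum _ fun i _ => (h1 i).mul (h2 i)).div
    (Finset.measurable_fun_sum _ fun i _ => h1 i)

lemma mixForecast_mem_Icc (hF : F.Nonempty) (hc : 0 < c)
    (hFc : ∀ i ∈ F, ∀ x a, (M.meanLoss i x a : ℝ) ∈ Set.Icc c (1 - c)) {t : ℕ}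
    (p : History 𝒳 K t × 𝒳 × Fin K) : mixForecast M F p ∈ Set.Icc c (1 - c) := by
  have hpos : 0 < ∑ i ∈ F, histLik M p.1 i :=
    Finset.sum_pos (fun i hi => histLik_pos hc (hFc i hi) _) hF
  constructor
  · rw [mixForecast, le_div_iff₀ hpos, Finset.mul_sum]
    refine Finset.sum_le_sum fun i hi => ?_
    rw [mul_comm]
    exact mul_le_mul_of_nonneg_left (hFc i hi _ _).1 (histLik_pos hc (hFc i hi) _).le
  · rw [mixForecast, div_le_iff₀ hpos, Finset.mul_sum]
    refine Finset.sum_le_sum fun i hi => ?_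
    rw [mul_comm (1 - c)]
    exact mul_le_mul_of_nonneg_left (hFc i hi _ _).2 (histLik_pos hc (hFc i hi) _).le

/-- The likelihood of the next outcome under the mixture forecast is the ratio of successive
total likelihoods, as `bernLik p b` is affine in `p`. -/
lemma bernLik_mixForecast {t : ℕ} (p : History 𝒳 K t × 𝒳 × Fin K)
    (hpos : 0 < ∑ i ∈ F, histLik M p.1 i) (b : Bool) :
    bernLik (mixForecast M F p) b
      = (∑ i ∈ F, histLik M p.1 i * bernLik (M.meanLoss i p.2.1 p.2.2) b)
        / ∑ i ∈ F, histLik M p.1 i := by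
  cases b
  · simp only [bernLik, mixForecast, Bool.false_eq_true, if_false, mul_sub, mul_one,
      Finset.sum_sub_distrib]
    rw [sub_div, div_self hpos.ne']
  · simp [bernLik, mixForecast]

variable {Ω : Type*} {X : ℕ → Ω → 𝒳} {A : ℕ → Ω → Fin K} {L : ℕ → Ω → Bool}

lemma histLik_history (i : Θ) (t : ℕ) (ω : Ω) : histLik M (history X A L t ω) i
    = ∏ s ∈ Finset.range t, bernLik (M.meanLoss i (X s ω) (A s ω)) (L s ω) := by
  rw [Finset.prod_range]
  rfl

/-- The cumulative logarithmic loss of the mixture forecast telescopes, and exceeds that of any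
parameter within log-likelihood distance `δ` of a member of `F` by at most `log #F + T δ`. -/
lemma sum_log_sub_log_mixForecast_le (hF : F.Nonempty) (hc : 0 < c)
    (hFc : ∀ i ∈ F, ∀ x a, (M.meanLoss i x a : ℝ) ∈ Set.Icc c (1 - c)) {θ₀ i : Θ} (hi : i ∈ F)
    {δ : ℝ} (hδ : ∀ x a b, Real.log (bernLik (M.meanLoss θ₀ x a) b)
      ≤ Real.log (bernLik (M.meanLoss i x a) b) + δ) (T : ℕ) (ω : Ω) :
    ∑ t ∈ Finset.range T, (Real.log (bernLik (M.meanLoss θ₀ (X t ω) (A t ω)) (L t ω))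
        - Real.log (bernLik (mixForecast M F (history X A L t ω, X t ω, A t ω)) (L t ω)))
      ≤ Real.log F.card + T * δ := by
  let W : ℕ → ℝ := fun t => ∑ j ∈ F, histLik M (history X A L t ω) j
  have hw : ∀ t, ∀ j ∈ F, 0 < histLik M (history X A L t ω) j := fun t j hj =>
    histLik_pos hc (hFc j hj) _
  have hW : ∀ t, 0 < W t := fun t => Finset.sum_pos (hw t) hF
  have hstep : ∀ t, Real.log (bernLik (mixForecast M F (history X A L t ω, X t ω, A t ω)) (L t ω))
      = Real.log (W (t + 1)) - Real.log (W t) := by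
    intro t
    rw [bernLik_mixForecast (history X A L t ω, X t ω, A t ω) (hW t),
      ← Real.log_div (hW _).ne' (hW t).ne']
    congr 2
    simp only [W]
    refine Finset.sum_congr rfl fun j _ => ?_
    rw [histLik_history, histLik_history, Finset.prod_range_succ]
  have hW0 : W 0 = F.card := by simp [W, histLik]
  have hlogi : Real.log (histLik M (history X A L T ω) i)
      = ∑ t ∈ Finset.range T, Real.log (bernLik (M.meanLoss i (X t ω) (A t ω)) (L t ω)) := by
    rw [histLik_history, Real.log_prod]
    exact fun t _ => (hc.trans_le (le_bernLik (hFc i hi _ _) _)).ne'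
  have hle : Real.log (histLik M (history X A L T ω) i) ≤ Real.log (W T) :=
    Real.log_le_log (hw T i hi) (Finset.single_le_sum (fun j hj => (hw T j hj).le) hi)
  have hsum : ∑ t ∈ Finset.range T, Real.log (bernLik (M.meanLoss θ₀ (X t ω) (A t ω)) (L t ω))
      ≤ ∑ t ∈ Finset.range T, Real.log (bernLik (M.meanLoss i (X t ω) (A t ω)) (L t ω)) + T * δ := by
    refine (Finset.sum_le_sum fun t _ => hδ _ _ _).trans_eq ?_
    rw [Finset.sum_add_distrib]
    simp
  rw [Finset.sum_sub_distrib]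
  simp_rw [hstep]
  rw [Finset.sum_range_sub (fun t => Real.log (W t)), hW0]
  linarith

end Mixture

/-! ### The regret bound -/

section Regret

variable {Ω Θ 𝒳 : Type*} [MeasurableSpace Ω] [MeasurableSpace Θ] [MeasurableSpace 𝒳] {K : ℕ}
  [StandardBorelSpace Θ] [Nonempty Θ] {M : BernoulliBandit Θ 𝒳 K} {act : Θ → 𝒳 → Fin K}
  {Q₁ : Measure Θ} {adv : ∀ t, Kernel (History 𝒳 K t) 𝒳} {T : ℕ} {P : Measure Ω}
  [IsProbabilityMeasure P] {θstar : Ω → Θ} {X : ℕ → Ω → 𝒳} {θ : ℕ → Ω → Θ}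
  {A : ℕ → Ω → Fin K} {L : ℕ → Ω → Bool}

/-- The regret bound for a class of Bernoulli bandits whose prior is supported on a set `Θ₁` with a
finite `δ`-cover `F` in log-likelihood. The lower bound `c` on all likelihoods makes the logarithmic
losses integrable, and does not enter the bound. -/
theorem IsThompsonSampling.bayesRegret_le_of_cover [∀ t, IsMarkovKernel (adv t)]
    (h : IsThompsonSampling M act Q₁ adv T P θstar X θ A L) (hact : M.IsArgmin act)
    {Θ₁ : Set Θ} (hΘ₁ : ∀ᵐ s ∂Q₁, s ∈ Θ₁) {F : Finset Θ} (hF : F.Nonempty) {c : ℝ} (hc : 0 < c)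
    (hFc : ∀ i ∈ F, ∀ x a, (M.meanLoss i x a : ℝ) ∈ Set.Icc c (1 - c))
    (hΘc : ∀ s ∈ Θ₁, ∀ x a, (M.meanLoss s x a : ℝ) ∈ Set.Icc c (1 - c)) {δ : ℝ}
    (hδ : ∀ s ∈ Θ₁, ∃ i ∈ F, ∀ x a b, Real.log (bernLik (M.meanLoss s x a) b)
      ≤ Real.log (bernLik (M.meanLoss i x a) b) + δ)
    {Γ : ℝ} (hΓ : 0 < Γ) (hΓle : Real.log F.card + T * δ ≤ Γ) :
    bayesRegret M act T P θstar X A ≤ √(2 * K * T * Γ) := by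
  rcases Nat.eq_zero_or_pos T with rfl | hT
  · simp [bayesRegret]
  obtain ⟨ω₀⟩ : Nonempty Ω := P.nonempty_of_neZero
  have hK : 0 < K := (A 0 ω₀).pos
  have hΘP : ∀ᵐ ω ∂P, θstar ω ∈ Θ₁ := by
    rw [← h.prior.map_eq] at hΘ₁
    exact ae_of_ae_map h.prior.aemeasurable hΘ₁
  have hMc : ∀ᵐ ω ∂P, ∀ x a, (M.meanLoss (θstar ω) x a : ℝ) ∈ Set.Icc c (1 - c) := by
    filter_upwards [hΘP] with ω hω using hΘc _ hω
  have hqc : ∀ t (p : History 𝒳 K t × 𝒳 × Fin K), mixForecast M F p ∈ Set.Icc c (1 - c) :=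
    fun t p => mixForecast_mem_Icc hF hc hFc p
  let E : ℕ → ℝ := fun t => ∫ ω, ((M.meanLoss (θstar ω) (X t ω) (A t ω) : ℝ)
          - mixForecast M F (history X A L t ω, X t ω, A t ω)) ^ 2 ∂P
  have hlog := fun t (ht : t < T) =>
    h.integral_sq_le_integral_log ht hc hMc (measurable_mixForecast (F := F)) (hqc t)
  have hE : 2 * ∑ t ∈ Finset.range T, E t ≤ Γ := by
    rw [Finset.mul_sum]
    refine (Finset.sum_le_sum fun t ht => (hlog t (Finset.mem_range.1 ht)).2).trans ?_
    rw [← integral_finsetSum _ fun t ht => (hlog t (Finset.mem_range.1 ht)).1]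
    calc _ ≤ ∫ _, Γ ∂P := by
          refine integral_mono_ae
            (integrable_finsetSum _ fun t ht => (hlog t (Finset.mem_range.1 ht)).1)
            (integrable_const _) ?_
          filter_upwards [hΘP] with ω hω
          obtain ⟨i, hi, hδi⟩ := hδ _ hω
          exact (sum_log_sub_log_mixForecast_le hF hc hFc hi hδi T ω).trans hΓle
      _ = Γ := by simp
  have hI : ∀ t ∈ Finset.range T, Integrable (fun ω =>
      (M.meanLoss (θstar ω) (X t ω) (A t ω) : ℝ)
        - M.meanLoss (θstar ω) (X t ω) (act (θstar ω) (X t ω))) P := by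
    intro t ht
    have mZ := (h.loss t (Finset.mem_range.1 ht)).aemeasurable_fst.fst
    have mS : AEMeasurable θstar P := h.prior.aemeasurable
    have mX : AEMeasurable (X t) P := mZ.snd.fst
    have ma : AEMeasurable (fun ω => act (θstar ω) (X t ω)) P :=
      hact.measurable.comp_aemeasurable (mS.prodMk mX)
    refine integrable_of_bound ((M.measurable_meanLoss_real.comp_aemeasurable mZ).sub
      (M.measurable_meanLoss_real.comp_aemeasurable (mS.prodMk (mX.prodMk ma)))) 1 fun ω => ?_
    have h1 := (M.meanLoss (θstar ω) (X t ω) (A t ω)).2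
    have h2 := (M.meanLoss (θstar ω) (X t ω) (act (θstar ω) (X t ω))).2
    rw [abs_le]
    constructor <;> linarith [h1.1, h1.2, h2.1, h2.2]
  have hround : ∀ l : ℝ, 0 < l →
      bayesRegret M act T P θstar X A ≤ T * (K / l) + l * (Γ / 2) := by
    intro l hl
    rw [bayesRegret, integral_finsetSum _ hI]
    calc _ ≤ ∑ t ∈ Finset.range T, (K / l + l * E t) := by
          refine Finset.sum_le_sum fun t ht => h.regret_round_le hact (Finset.mem_range.1 ht)
            measurable_mixForecast (fun p => ?_) hl
          exact ⟨hc.le.trans (hqc t p).1, by linarith [(hqc t p).2]⟩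
      _ = T * (K / l) + l * ∑ t ∈ Finset.range T, E t := by
          rw [Finset.sum_add_distrib, Finset.mul_sum]
          simp
      _ ≤ _ := by gcongr; linarith
  -- The two terms are balanced by `l = R / Γ`, where `R` is the claimed bound.
  set R := √(2 * K * T * Γ) with hR
  have hR2 : R ^ 2 = 2 * K * T * Γ := Real.sq_sqrt (by positivity)
  have hRpos : 0 < R := Real.sqrt_pos.2 (by positivity)
  refine (hround (R / Γ) (by positivity)).trans_eq ?_
  field_simp
  linarith

end Regret

end ContextualBandit

open ContextualBandit in
theorem mainTheorem5 :
    (∀ (d K T : ℕ) (S B : ℝ)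
      {𝒳 : Type*} [MeasurableSpace 𝒳] {Ω : Type*} [MeasurableSpace Ω]
      (P : Measure Ω) [IsProbabilityMeasure P]
      (φ : 𝒳 → Fin K → EuclideanSpace ℝ (Fin d)) (hφ : ∀ a, Measurable fun x => φ x a)
      (_ : ∀ x a, ‖φ x a‖ ≤ B)
      (act : EuclideanSpace ℝ (Fin d) → 𝒳 → Fin K)
      (_ : (linearLogistic φ hφ).IsArgmin act)
      (Q₁ : Measure (EuclideanSpace ℝ (Fin d))) [IsProbabilityMeasure Q₁]
      (Θ₁ : Set (EuclideanSpace ℝ (Fin d)))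
      (_ : ∀ᵐ θ ∂Q₁, θ ∈ Θ₁) (_ : ∀ θ ∈ Θ₁, ‖θ‖ ≤ S)
      (adv : ∀ t, Kernel (History 𝒳 K t) 𝒳) [∀ t, IsMarkovKernel (adv t)]
      (θstar : Ω → EuclideanSpace ℝ (Fin d)) (X : ℕ → Ω → 𝒳)
      (θ : ℕ → Ω → EuclideanSpace ℝ (Fin d)) (A : ℕ → Ω → Fin K) (L : ℕ → Ω → Bool)
      (_ : IsThompsonSampling (linearLogistic φ hφ) act Q₁ adv T P θstar X θ A L),
      bayesRegret (linearLogistic φ hφ) act T P θstar X A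
        ≤ √(2 * K * T * (d * Real.log (2 * S * B * T + 1) + 1))) ∧
    (∃ (C : ℝ) (p : ℕ), 0 < C ∧ ∀ (d K T : ℕ) (S B : ℝ),
      1 ≤ d → 1 ≤ K → 1 ≤ T → 0 ≤ S → 0 ≤ B →
      √(2 * K * T * (d * Real.log (2 * S * B * T + 1) + 1))
        ≤ C * √(d * K * T) * Real.log (2 + S * B * T) ^ p) := by
  refine ⟨?_, 4, 1, by norm_num, fun d K T S B hd _ _ hS hB => sqrt_regretBound_le hd hS hB⟩
  intro d K T S B 𝒳 _ Ω _ P _ φ hφ hB act hact Q₁ _ Θ₁ hΘ₁ hS adv _ θstar X θ A L h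
  obtain ⟨ω₀⟩ : Nonempty Ω := P.nonempty_of_neZero
  have hB0 : 0 ≤ B := (norm_nonneg _).trans (hB (X 0 ω₀) (A 0 ω₀))
  obtain ⟨s₀, hs₀⟩ := hΘ₁.exists
  have hS0 : 0 ≤ S := (norm_nonneg _).trans (hS s₀ hs₀)
  have hin : ∀ x a (v : EuclideanSpace ℝ (Fin d)), |inner ℝ (φ x a) v| ≤ B * ‖v‖ := fun x a v =>
    (abs_real_inner_le_norm _ _).trans (by gcongr; exact hB x a)
  have hball : ∀ v : EuclideanSpace ℝ (Fin d), ‖v‖ ≤ S → ∀ x a,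
      ((linearLogistic φ hφ).meanLoss v x a : ℝ)
        ∈ Set.Icc (Real.sigmoid (-(B * S))) (1 - Real.sigmoid (-(B * S))) := fun v hv x a =>
    sigmoid_mem_Icc ((hin x a v).trans (by gcongr))
  obtain ⟨F, hF, hFS, hcard, hcov⟩ := exists_cover_ball_scaled (d := d) hS0
    (by positivity : 0 ≤ B * T)
  rcases Nat.eq_zero_or_pos T with rfl | hT
  · simp [bayesRegret]
  have hT' : (0 : ℝ) < T := by exact_mod_cast hT
  have hlog0 : 0 ≤ Real.log (2 * S * B * T + 1) := Real.log_nonneg (by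
    have : 0 ≤ 2 * S * B * T := by positivity
    linarith)
  refine h.bayesRegret_le_of_cover hact hΘ₁ hF (Real.sigmoid_pos _)
    (fun i hi => hball i (hFS i hi)) (fun s hs => hball s (hS s hs)) (δ := 1 / T) ?_
    (by positivity) ?_
  · intro s hs
    obtain ⟨i, hi, hle⟩ := hcov s (hS s hs)
    refine ⟨i, hi, fun x a b => log_bernLik_sigmoid_le ?_ b⟩
    rw [← inner_sub_right, le_div_iff₀ hT']
    refine le_trans ?_ hle
    rw [mul_right_comm]
    exact mul_le_mul_of_nonneg_right (hin x a _) hT'.le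
  · have hcard0 : (0 : ℝ) < F.card := by exact_mod_cast hF.card_pos
    have h1 : Real.log F.card ≤ d * Real.log (2 * S * B * T + 1) := by
      rw [← Real.log_pow]
      refine Real.log_le_log hcard0 (hcard.trans_eq ?_)
      rw [mul_assoc (2 * S)]
    rw [mul_one_div_cancel hT'.ne']
    linarith
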